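/- Let $m\in\mathbb N$, let $M_m(\mathbb C)$ denote the complex $m\times m$ matrices, and let $M_m^{+}(\mathbb C)$ denote the set of positive semidefinite (Hermitian) ones. For $X\in M_m^{+}(\mathbb C)$ and $p>0$, let $X^p\in M_m^{+}(\mathbb C)$ denote the power defined by the functional calculus (with $0^p=0$). Then for all $B\in M_m(\mathbb C)$, $0<s<1$ and $0<r\le 1$, the map $$A\mapsto \operatorname{tr}\bigl[(B^*A^sB)^{r/s}\bigr]\in\mathbb R$$ is concave on $M_m^{+}(\mathbb C)$. -/

import Mathlib

open scoped ComplexOrder MatrixOrder Matrix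

/-! Put `q = r / s` and `X = Bᴴ * A ^ s * B`. Everything rests on joint concavity of `tr (Kᴴ A ^ s K
W ^ (1 - s))` (`lieb_concavity`), an integral of parallel sums, each a minimum of energies linear in
`(A, W)`. If `q ≤ 1`, evaluate in an eigenbasis of `X` at the convex combination:
`conj_rpow_diag_concave` makes the diagonal entries concave in `A`, and Jensen handles the power. If
`q > 1`, with `q'` conjugate to `q`, Young's trace inequality gives `tr X ^ q = max_W (q tr (X W ^
(1 - s)) - (q - 1) tr W ^ ((1 - s) q'))`. Since `r ≤ 1` means `(1 - s) q' ≥ 1`, the bracket is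
jointly concave, hence so is its maximum over `W`. -/

namespace Matrix

/-! ### Spectral calculus and trace inequalities -/

variable {n : Type*} [Fintype n] [DecidableEq n]

/-- A unitary diagonalization of a positive semidefinite matrix, together with all its powers. -/
structure PowDiag (A : Matrix n n ℂ) where
  U : Matrix n n ℂ
  ev : n → ℝ
  unitary_left : Uᴴ * U = 1
  unitary_right : U * Uᴴ = 1
  nonneg : ∀ i, 0 ≤ ev i
  rpow_eq : ∀ p : ℝ, A ^ p = U * diagonal (fun i => ((ev i ^ p : ℝ) : ℂ)) * Uᴴ

theorem PosSemidef.exists_powDiag {A : Matrix n n ℂ} (hA : A.PosSemidef) :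
    Nonempty (PowDiag A) := by
  refine ⟨⟨hA.1.eigenvectorUnitary, hA.1.eigenvalues, ?_, ?_, hA.eigenvalues_nonneg, ?_⟩⟩
  · exact (Matrix.mem_unitaryGroup_iff'.1 hA.1.eigenvectorUnitary.2)
  · exact (Matrix.mem_unitaryGroup_iff.1 hA.1.eigenvectorUnitary.2)
  · intro p
    rw [CFC.rpow_eq_cfc_real (Matrix.nonneg_iff_posSemidef.2 hA), hA.1.cfc_eq]
    rfl

theorem posSemidef_rpow (A : Matrix n n ℂ) (p : ℝ) : (A ^ p).PosSemidef :=
  Matrix.nonneg_iff_posSemidef.1 CFC.rpow_nonneg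

theorem PosSemidef.rpow_one {A : Matrix n n ℂ} (hA : A.PosSemidef) : A ^ (1 : ℝ) = A :=
  CFC.rpow_one A (Matrix.nonneg_iff_posSemidef.2 hA)

theorem PosSemidef.rpow_zero {A : Matrix n n ℂ} (hA : A.PosSemidef) : A ^ (0 : ℝ) = 1 :=
  CFC.rpow_zero A (Matrix.nonneg_iff_posSemidef.2 hA)

theorem PosSemidef.rpow_rpow {A : Matrix n n ℂ} (hA : A.PosSemidef) {p q : ℝ} (hp : 0 ≤ p)
    (hq : 0 ≤ q) : (A ^ p) ^ q = A ^ (p * q) :=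
  CFC.rpow_rpow_of_exponent_nonneg A p q hp hq (Matrix.nonneg_iff_posSemidef.2 hA)

theorem trace_conj_diagonal_mul (K U V : Matrix n n ℂ) (a b : n → ℝ) :
    (trace (Kᴴ * (U * diagonal (fun i => (a i : ℂ)) * Uᴴ) * K *
      (V * diagonal (fun i => (b i : ℂ)) * Vᴴ))).re
      = ∑ i, ∑ j, a i * b j * Complex.normSq ((Uᴴ * K * V) i j) := by
  have h : trace (Kᴴ * (U * diagonal (fun i => (a i : ℂ)) * Uᴴ) * K *
      (V * diagonal (fun i => (b i : ℂ)) * Vᴴ)) =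
      trace (diagonal (fun i => (a i : ℂ)) * (Uᴴ * K * V) *
        (diagonal (fun i => (b i : ℂ)) * (Uᴴ * K * V)ᴴ)) := by
    have e : (Uᴴ * K * V)ᴴ = Vᴴ * Kᴴ * U := by
      simp [conjTranspose_mul, mul_assoc]
    rw [e, trace_mul_comm]
    conv_rhs => rw [trace_mul_comm]
    simp only [← mul_assoc]
    rw [trace_mul_comm]
    simp only [← mul_assoc]
    conv_rhs => rw [trace_mul_comm]
    simp only [← mul_assoc]
    conv_rhs => rw [trace_mul_comm]
    simp only [← mul_assoc]
  rw [h, trace, Complex.re_sum]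
  refine Finset.sum_congr rfl fun i _ => ?_
  rw [diag_apply, mul_apply, Complex.re_sum]
  refine Finset.sum_congr rfl fun j _ => ?_
  rw [diagonal_mul, diagonal_mul, conjTranspose_apply]
  have : (a i : ℂ) * (Uᴴ * K * V) i j * ((b j : ℂ) * star ((Uᴴ * K * V) i j))
      = ((a i * b j * Complex.normSq ((Uᴴ * K * V) i j) : ℝ) : ℂ) := by
    push_cast
    rw [Complex.normSq_eq_conj_mul_self]
    simp only [Complex.star_def]
    ring
  rw [this, Complex.ofReal_re]

namespace PowDiag

variable {A W : Matrix n n ℂ}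

theorem trace_rpow_mul_rpow (dA : PowDiag A) (dW : PowDiag W) (K : Matrix n n ℂ) (p q : ℝ) :
    (trace (Kᴴ * A ^ p * K * W ^ q)).re
      = ∑ i, ∑ j, dA.ev i ^ p * dW.ev j ^ q * Complex.normSq ((dA.Uᴴ * K * dW.U) i j) := by
  rw [dA.rpow_eq, dW.rpow_eq, trace_conj_diagonal_mul]

theorem trace_rpow (dA : PowDiag A) (p : ℝ) : (trace (A ^ p)).re = ∑ i, dA.ev i ^ p := by
  rw [dA.rpow_eq, trace_mul_cycle, dA.unitary_left, one_mul, trace_diagonal, Complex.re_sum]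
  rfl

end PowDiag

/-- In eigenbases of `X` and `Y`, scalar Young is summed against the squared overlaps; the zero
exponents in `h2`, `h3` turn the single traces into such double sums. -/
theorem trace_young {X Y : Matrix n n ℂ} (hX : X.PosSemidef) (hY : Y.PosSemidef) {p q : ℝ}
    (hpq : p.HolderConjugate q) :
    (trace (X * Y)).re ≤ (trace (X ^ p)).re / p + (trace (Y ^ q)).re / q := by
  obtain ⟨dX⟩ := hX.exists_powDiag
  obtain ⟨dY⟩ := hY.exists_powDiag
  have key := dX.trace_rpow_mul_rpow dY 1
  have h1 := key 1 1
  have h2 := key p 0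
  have h3 := key 0 q
  simp only [hX.rpow_one, hY.rpow_one, hX.rpow_zero, hY.rpow_zero, Real.rpow_zero, Real.rpow_one,
    conjTranspose_one, one_mul, mul_one] at h1 h2 h3
  rw [h1, h2, h3, Finset.sum_div, Finset.sum_div, ← Finset.sum_add_distrib]
  refine Finset.sum_le_sum fun i _ => ?_
  rw [Finset.sum_div, Finset.sum_div, ← Finset.sum_add_distrib]
  refine Finset.sum_le_sum fun j _ => ?_
  have := mul_le_mul_of_nonneg_right
    (Real.young_inequality_of_nonneg (dX.nonneg i) (dY.nonneg j) hpq)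
    (Complex.normSq_nonneg ((dX.Uᴴ * dY.U) i j))
  calc _ ≤ _ := this
    _ = _ := by ring

theorem PosSemidef.trace_mul_rpow {X : Matrix n n ℂ} (hX : X.PosSemidef) {p : ℝ} (hp : 0 < p) :
    (trace (X * X ^ p)).re = (trace (X ^ (1 + p))).re := by
  obtain ⟨d⟩ := hX.exists_powDiag
  have e : X * X ^ p = X ^ (1 + p) := by
    nth_rewrite 1 [← hX.rpow_one]
    rw [d.rpow_eq, d.rpow_eq, d.rpow_eq]
    rw [show ∀ P Q R S T O : Matrix n n ℂ, P * Q * R * (S * T * O) = P * (Q * (R * S) * T) * O by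
      intros; simp only [mul_assoc], d.unitary_left, mul_one, diagonal_mul_diagonal]
    congr 3
    funext i
    rw [← Complex.ofReal_mul, Real.rpow_add' (d.nonneg i) (by positivity)]
  rw [e]

theorem trace_rpow_convex {X Y : Matrix n n ℂ} (hX : X.PosSemidef) (hY : Y.PosSemidef)
    {p a b : ℝ} (hp : 1 ≤ p) (ha : 0 ≤ a) (hb : 0 ≤ b) (hab : a + b = 1) :
    (trace ((a • X + b • Y) ^ p)).re ≤ a * (trace (X ^ p)).re + b * (trace (Y ^ p)).re := by
  have hW : (a • X + b • Y).PosSemidef := (hX.smul ha).add (hY.smul hb)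
  rcases hp.eq_or_lt with rfl | hp
  · rw [hW.rpow_one, hX.rpow_one, hY.rpow_one]
    simp
  have hpq := Real.HolderConjugate.conjExponent hp
  set q := p.conjExponent
  -- This power is the optimal Young partner of the combination, and the pairing with it is linear.
  have hZ := posSemidef_rpow (a • X + b • Y) (p - 1)
  have h1 := hW.trace_mul_rpow (sub_pos.2 hp)
  have h2 := trace_young hX hZ hpq
  have h3 := trace_young hY hZ hpq
  rw [hW.rpow_rpow (by linarith) hpq.symm.nonneg, hpq.sub_one_mul_conj] at h2 h3
  rw [add_sub_cancel, add_mul, trace_add, smul_mul_assoc, smul_mul_assoc, trace_smul, trace_smul,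
    Complex.add_re, Complex.smul_re, Complex.smul_re, smul_eq_mul, smul_eq_mul] at h1
  have h4 := mul_le_mul_of_nonneg_left h2 ha
  have h5 := mul_le_mul_of_nonneg_left h3 hb
  have h6 := hpq.inv_add_inv_eq_one
  set w := (trace ((a • X + b • Y) ^ p)).re
  have hq : q⁻¹ = 1 - p⁻¹ := by linarith
  simp only [div_eq_mul_inv, hq] at h4 h5
  have h7 : w * p⁻¹ ≤ (a * (trace (X ^ p)).re + b * (trace (Y ^ p)).re) * p⁻¹ := by
    have : b = 1 - a := by linarith
    subst this
    linarith
  exact le_of_mul_le_mul_right h7 (by positivity)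

end Matrix

/-! ### Parallel sums and Lieb's concavity theorem -/

namespace Matrix

variable {n : Type*} [Fintype n] [DecidableEq n]

open MeasureTheory Set Real

/-- After clearing `a + t * b`, the gap is `|a x - t b y|² / t`; the next lemma uses the splitting
where it vanishes. -/
theorem parallel_sum_mul_normSq_le {a b t : ℝ} (ha : 0 ≤ a) (hb : 0 ≤ b) (ht : 0 < t)
    (x y : ℂ) :
    a * b / (a + t * b) * Complex.normSq (x + y)
      ≤ a / t * Complex.normSq x + b * Complex.normSq y := by
  have h0 : 0 ≤ a / t * Complex.normSq x + b * Complex.normSq y := by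
    have := Complex.normSq_nonneg x
    have := Complex.normSq_nonneg y
    positivity
  rcases (show 0 ≤ a + t * b by positivity).eq_or_lt with h | h
  · rw [← h]; simpa using h0
  · rw [div_mul_eq_mul_div, div_le_iff₀ h]
    have e : (a / t * Complex.normSq x + b * Complex.normSq y) * (a + t * b) -
        a * b * Complex.normSq (x + y)
        = ((a * x.re - t * b * y.re) ^ 2 + (a * x.im - t * b * y.im) ^ 2) / t := by
      simp only [Complex.normSq_apply, Complex.add_re, Complex.add_im]
      field_simp
      ring
    have : 0 ≤ ((a * x.re - t * b * y.re) ^ 2 + (a * x.im - t * b * y.im) ^ 2) / t := by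
      positivity
    linarith

theorem parallel_sum_mul_normSq_eq {a b t : ℝ} (ha : 0 ≤ a) (hb : 0 ≤ b) (ht : 0 < t) (k : ℂ) :
    a / t * Complex.normSq (((t * b / (a + t * b) : ℝ) : ℂ) * k) +
      b * Complex.normSq (k - ((t * b / (a + t * b) : ℝ) : ℂ) * k)
      = a * b / (a + t * b) * Complex.normSq k := by
  rcases (show 0 ≤ a + t * b by positivity).eq_or_lt with h | h
  · have hb0 : b = 0 := by
      have : 0 ≤ t * b := by positivity
      have : t * b = 0 := by linarith
      simpa [ht.ne'] using this
    simp [hb0]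
  · have : k - ((t * b / (a + t * b) : ℝ) : ℂ) * k = ((a / (a + t * b) : ℝ) : ℂ) * k := by
      have : (a / (a + t * b) : ℝ) = 1 - t * b / (a + t * b) := by field_simp; ring
      rw [this]; push_cast; ring
    rw [this, Complex.normSq_mul, Complex.normSq_mul, Complex.normSq_ofReal,
      Complex.normSq_ofReal]
    field_simp
    ring

/-- The quadratic form of the parallel sum of left multiplication by `t⁻¹ • A` and right
multiplication by `W`, at `K`. -/
noncomputable def PowDiag.parallelForm {A W : Matrix n n ℂ} (dA : PowDiag A) (dW : PowDiag W)
    (K : Matrix n n ℂ) (t : ℝ) : ℝ :=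
  ∑ i, ∑ j, dA.ev i * dW.ev j / (dA.ev i + t * dW.ev j) *
    Complex.normSq ((dA.Uᴴ * K * dW.U) i j)

/-- The energy of a splitting `X + Y`, whose minimum over all splittings of `K` is
`PowDiag.parallelForm` at `K`. -/
noncomputable def splitEnergy (A W X Y : Matrix n n ℂ) (t : ℝ) : ℝ :=
  (trace (Xᴴ * A * X)).re / t + (trace (Yᴴ * Y * W)).re

namespace PowDiag

variable {A W : Matrix n n ℂ}

theorem splitEnergy_eq (hA : A.PosSemidef) (hW : W.PosSemidef) (dA : PowDiag A) (dW : PowDiag W)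
    (X Y : Matrix n n ℂ) (t : ℝ) :
    splitEnergy A W X Y t = ∑ i, ∑ j, (dA.ev i / t * Complex.normSq ((dA.Uᴴ * X * dW.U) i j) +
      dW.ev j * Complex.normSq ((dA.Uᴴ * Y * dW.U) i j)) := by
  have h1 := dA.trace_rpow_mul_rpow dW X 1 0
  have h2 := dA.trace_rpow_mul_rpow dW Y 0 1
  simp only [hA.rpow_one, hW.rpow_one, hA.rpow_zero, hW.rpow_zero, Real.rpow_zero, Real.rpow_one,
    one_mul, mul_one] at h1 h2
  rw [splitEnergy, h1, h2, Finset.sum_div, ← Finset.sum_add_distrib]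
  refine Finset.sum_congr rfl fun i _ => ?_
  rw [Finset.sum_div, ← Finset.sum_add_distrib]
  refine Finset.sum_congr rfl fun j _ => ?_
  ring

theorem parallelForm_le (hA : A.PosSemidef) (hW : W.PosSemidef) (dA : PowDiag A) (dW : PowDiag W)
    (X Y : Matrix n n ℂ) {t : ℝ} (ht : 0 < t) :
    dA.parallelForm dW (X + Y) t ≤ splitEnergy A W X Y t := by
  rw [splitEnergy_eq hA hW dA dW, parallelForm]
  refine Finset.sum_le_sum fun i _ => Finset.sum_le_sum fun j _ => ?_
  rw [mul_add, add_mul, add_apply]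
  exact parallel_sum_mul_normSq_le (dA.nonneg i) (dW.nonneg j) ht _ _

theorem exists_parallelForm_eq (hA : A.PosSemidef) (hW : W.PosSemidef) (dA : PowDiag A)
    (dW : PowDiag W) (K : Matrix n n ℂ) {t : ℝ} (ht : 0 < t) :
    ∃ X Y, X + Y = K ∧ splitEnergy A W X Y t = dA.parallelForm dW K t := by
  set M := dA.Uᴴ * K * dW.U with hM
  -- The scalar minimiser, entry by entry in the two eigenbases.
  let M' : Matrix n n ℂ := of fun i j =>
    ((t * dW.ev j / (dA.ev i + t * dW.ev j) : ℝ) : ℂ) * M i j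
  have hX : dA.Uᴴ * (dA.U * M' * dW.Uᴴ) * dW.U = M' := by
    rw [show dA.Uᴴ * (dA.U * M' * dW.Uᴴ) * dW.U = (dA.Uᴴ * dA.U) * M' * (dW.Uᴴ * dW.U) by
      simp only [mul_assoc], dA.unitary_left, dW.unitary_left, one_mul, mul_one]
  refine ⟨dA.U * M' * dW.Uᴴ, K - dA.U * M' * dW.Uᴴ, by abel, ?_⟩
  rw [splitEnergy_eq hA hW dA dW, parallelForm]
  refine Finset.sum_congr rfl fun i _ => Finset.sum_congr rfl fun j _ => ?_
  rw [mul_sub, sub_mul, hX, ← hM, sub_apply]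
  exact parallel_sum_mul_normSq_eq (dA.nonneg i) (dW.nonneg j) ht _

end PowDiag

theorem splitEnergy_convexComb (A₁ A₂ W₁ W₂ X Y : Matrix n n ℂ) (t a b : ℝ) :
    splitEnergy (a • A₁ + b • A₂) (a • W₁ + b • W₂) X Y t
      = a * splitEnergy A₁ W₁ X Y t + b * splitEnergy A₂ W₂ X Y t := by
  simp only [splitEnergy, mul_add, add_mul, mul_smul_comm, smul_mul_assoc, trace_add, trace_smul,
    Complex.add_re, Complex.smul_re, smul_eq_mul]
  ring

/-- A minimum of linear functions is concave: the optimal splitting for the combination is a trial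
splitting for both endpoints. -/
theorem parallelForm_concave {A₁ A₂ W₁ W₂ : Matrix n n ℂ} (hA₁ : A₁.PosSemidef)
    (hA₂ : A₂.PosSemidef) (hW₁ : W₁.PosSemidef) (hW₂ : W₂.PosSemidef) {a b : ℝ} (ha : 0 ≤ a)
    (hb : 0 ≤ b) (dA₁ : PowDiag A₁) (dA₂ : PowDiag A₂) (dW₁ : PowDiag W₁) (dW₂ : PowDiag W₂)
    (dA : PowDiag (a • A₁ + b • A₂)) (dW : PowDiag (a • W₁ + b • W₂)) (K : Matrix n n ℂ)
    {t : ℝ} (ht : 0 < t) :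
    a * dA₁.parallelForm dW₁ K t + b * dA₂.parallelForm dW₂ K t ≤ dA.parallelForm dW K t := by
  obtain ⟨X, Y, rfl, h⟩ := PowDiag.exists_parallelForm_eq ((hA₁.smul ha).add (hA₂.smul hb))
    ((hW₁.smul ha).add (hW₂.smul hb)) dA dW K ht
  rw [← h, splitEnergy_convexComb]
  exact add_le_add (mul_le_mul_of_nonneg_left (PowDiag.parallelForm_le hA₁ hW₁ _ _ _ _ ht) ha)
    (mul_le_mul_of_nonneg_left (PowDiag.parallelForm_le hA₂ hW₂ _ _ _ _ ht) hb)

/-- The perspective of the integrand of `x ^ s` is a parallel sum; at `b = 0` both sides vanish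
because `a / 0 = 0`. -/
theorem mul_rpowIntegrand₀₁_div {s t a b : ℝ} (hs : s ∈ Ioo 0 1) (ht : 0 < t) (ha : 0 ≤ a)
    (hb : 0 ≤ b) :
    b * rpowIntegrand₀₁ s t (a / b) = t ^ (s - 1) * (a * b / (a + t * b)) := by
  rw [rpowIntegrand₀₁_eq_pow_div hs ht.le (by positivity)]
  rcases hb.eq_or_lt with rfl | hb
  · simp
  · have : a + t * b ≠ 0 := by positivity
    have : t + a / b ≠ 0 := by positivity
    field_simp
    ring

theorem rpow_mul_rpow_one_sub {s a b : ℝ} (hs : s ∈ Ioo 0 1) (ha : 0 ≤ a) (hb : 0 ≤ b) :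
    a ^ s * b ^ (1 - s) = b * (a / b) ^ s := by
  rcases hb.eq_or_lt with rfl | hb
  · simp [Real.zero_rpow (sub_pos.2 hs.2).ne']
  · rw [Real.div_rpow ha hb.le, Real.rpow_sub hb, Real.rpow_one]
    ring

/-- Integral representation of Lieb's trace functional by parallel sums. -/
theorem exists_measure_lieb_eq_integral {s : ℝ} (hs : s ∈ Ioo 0 1) :
    ∃ μ : Measure ℝ, ∀ {A W : Matrix n n ℂ} (dA : PowDiag A) (dW : PowDiag W) (K : Matrix n n ℂ),
      IntegrableOn (fun t => t ^ (s - 1) * dA.parallelForm dW K t) (Ioi 0) μ ∧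
      (trace (Kᴴ * A ^ s * K * W ^ (1 - s))).re
        = ∫ t in Ioi 0, t ^ (s - 1) * dA.parallelForm dW K t ∂μ := by
  obtain ⟨μ, hμ⟩ := exists_measure_rpow_eq_integral_rpowIntegrand₀₁ hs
  refine ⟨μ, fun {A W} dA dW K => ?_⟩
  have hq (i j) : 0 ≤ dA.ev i / dW.ev j := div_nonneg (dA.nonneg i) (dW.nonneg j)
  have hint (i j) : IntegrableOn (fun t => dW.ev j * rpowIntegrand₀₁ s t (dA.ev i / dW.ev j) *
      Complex.normSq ((dA.Uᴴ * K * dW.U) i j)) (Ioi 0) μ :=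
    ((hμ _ (hq i j)).1.const_mul _).mul_const _
  have hEq : EqOn (fun t => ∑ i, ∑ j, dW.ev j * rpowIntegrand₀₁ s t (dA.ev i / dW.ev j) *
      Complex.normSq ((dA.Uᴴ * K * dW.U) i j))
      (fun t => t ^ (s - 1) * dA.parallelForm dW K t) (Ioi 0) := by
    intro t ht
    simp only [PowDiag.parallelForm, Finset.mul_sum]
    refine Finset.sum_congr rfl fun i _ => Finset.sum_congr rfl fun j _ => ?_
    rw [mul_rpowIntegrand₀₁_div hs ht (dA.nonneg i) (dW.nonneg j), mul_assoc]
  constructor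
  · refine IntegrableOn.congr_fun ?_ hEq measurableSet_Ioi
    exact integrable_finsetSum _ fun i _ => integrable_finsetSum _ fun j _ => hint i j
  · rw [← setIntegral_congr_fun measurableSet_Ioi hEq, integral_finsetSum _
      fun i _ => integrable_finsetSum _ fun j _ => hint i j, dA.trace_rpow_mul_rpow]
    refine Finset.sum_congr rfl fun i _ => ?_
    rw [integral_finsetSum _ fun j _ => hint i j]
    refine Finset.sum_congr rfl fun j _ => ?_
    rw [integral_mul_const, integral_const_mul, ← (hμ _ (hq i j)).2,
      rpow_mul_rpow_one_sub hs (dA.nonneg i) (dW.nonneg j)]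

/-- **Lieb's concavity theorem**: `(A, W) ↦ tr (Kᴴ A ^ s K W ^ (1 - s))` is jointly concave. -/
theorem lieb_concavity {A₁ A₂ W₁ W₂ : Matrix n n ℂ} (hA₁ : A₁.PosSemidef)
    (hA₂ : A₂.PosSemidef) (hW₁ : W₁.PosSemidef) (hW₂ : W₂.PosSemidef) {a b : ℝ} (ha : 0 ≤ a)
    (hb : 0 ≤ b) (K : Matrix n n ℂ) {s : ℝ} (hs : s ∈ Ioo 0 1) :
    a * (trace (Kᴴ * A₁ ^ s * K * W₁ ^ (1 - s))).re + b * (trace (Kᴴ * A₂ ^ s * K * W₂ ^ (1 - s))).re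
      ≤ (trace (Kᴴ * (a • A₁ + b • A₂) ^ s * K * (a • W₁ + b • W₂) ^ (1 - s))).re := by
  obtain ⟨μ, hμ⟩ := exists_measure_lieb_eq_integral (n := n) hs
  obtain ⟨dA₁⟩ := hA₁.exists_powDiag
  obtain ⟨dA₂⟩ := hA₂.exists_powDiag
  obtain ⟨dW₁⟩ := hW₁.exists_powDiag
  obtain ⟨dW₂⟩ := hW₂.exists_powDiag
  obtain ⟨dA⟩ := ((hA₁.smul ha).add (hA₂.smul hb)).exists_powDiag
  obtain ⟨dW⟩ := ((hW₁.smul ha).add (hW₂.smul hb)).exists_powDiag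
  obtain ⟨i₁, e₁⟩ := hμ dA₁ dW₁ K
  obtain ⟨i₂, e₂⟩ := hμ dA₂ dW₂ K
  obtain ⟨i₃, e₃⟩ := hμ dA dW K
  rw [e₁, e₂, e₃, ← integral_const_mul, ← integral_const_mul,
    ← integral_add (i₁.const_mul a) (i₂.const_mul b)]
  refine setIntegral_mono_on ((i₁.const_mul a).add (i₂.const_mul b)) i₃ measurableSet_Ioi
    fun t ht => ?_
  have := mul_le_mul_of_nonneg_left
    (parallelForm_concave hA₁ hA₂ hW₁ hW₂ ha hb dA₁ dA₂ dW₁ dW₂ dA dW K ht)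
    (Real.rpow_nonneg (le_of_lt ht) (s - 1))
  linarith

end Matrix

/-! ### Concavity of the trace functional -/

namespace Matrix

variable {n : Type*} [Fintype n] [DecidableEq n]

theorem PowDiag.conj_rpow_diag_re {A : Matrix n n ℂ} (d : PowDiag A) (M : Matrix n n ℂ) (p : ℝ)
    (i : n) : ((Mᴴ * A ^ p * M) i i).re
      = ∑ j, Complex.normSq ((d.Uᴴ * M) j i) * d.ev j ^ p := by
  have h : Mᴴ * A ^ p * M =
      (d.Uᴴ * M)ᴴ * (diagonal (fun i => ((d.ev i ^ p : ℝ) : ℂ)) * (d.Uᴴ * M)) := by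
    rw [d.rpow_eq, conjTranspose_mul, conjTranspose_conjTranspose]
    simp only [mul_assoc]
  rw [h, mul_apply, Complex.re_sum]
  refine Finset.sum_congr rfl fun j _ => ?_
  rw [diagonal_mul, conjTranspose_apply, Complex.star_def, mul_left_comm,
    ← Complex.normSq_eq_conj_mul_self, Complex.re_ofReal_mul, Complex.ofReal_re, mul_comm]

theorem PowDiag.conj_eq_diagonal {A : Matrix n n ℂ} (d : PowDiag A) (hA : A.PosSemidef) :
    d.Uᴴ * A * d.U = diagonal fun i => (d.ev i : ℂ) := by
  have h := congrArg (fun P => d.Uᴴ * P * d.U) (d.rpow_eq 1)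
  simp only [hA.rpow_one, Real.rpow_one] at h
  rw [h, show ∀ P Q R S : Matrix n n ℂ, P * (Q * R * S) * Q = (P * Q) * R * (S * Q) by
    intros; simp only [mul_assoc], d.unitary_left, one_mul, mul_one]

theorem sum_normSq_col {M : Matrix n n ℂ} (hM : Mᴴ * M = 1) (i : n) :
    ∑ j, Complex.normSq (M j i) = 1 := by
  have h := congrArg (fun P : Matrix n n ℂ => (P i i).re) hM
  simp only [mul_apply, conjTranspose_apply, Complex.re_sum, one_apply_eq, Complex.one_re,
    Complex.star_def, ← Complex.normSq_eq_conj_mul_self, Complex.ofReal_re] at h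
  exact h

/-- Each diagonal entry averages eigenvalues with weights summing to one, so Jensen applies. -/
theorem PosSemidef.conj_rpow_diag_re_le {A : Matrix n n ℂ} (hA : A.PosSemidef)
    {U : Matrix n n ℂ} (hU : Uᴴ * U = 1) {q : ℝ} (hq0 : 0 ≤ q) (hq1 : q ≤ 1) (i : n) :
    ((Uᴴ * A ^ q * U) i i).re ≤ ((Uᴴ * A * U) i i).re ^ q := by
  obtain ⟨d⟩ := hA.exists_powDiag
  have h1 := d.conj_rpow_diag_re U 1 i
  simp only [hA.rpow_one, Real.rpow_one] at h1
  have hM : (d.Uᴴ * U)ᴴ * (d.Uᴴ * U) = 1 := by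
    rw [conjTranspose_mul, conjTranspose_conjTranspose,
      show Uᴴ * d.U * (d.Uᴴ * U) = Uᴴ * (d.U * d.Uᴴ) * U by simp only [mul_assoc],
      d.unitary_right, mul_one, hU]
  rw [d.conj_rpow_diag_re, h1]
  exact (Real.concaveOn_rpow hq0 hq1).le_map_sum (fun j _ => Complex.normSq_nonneg _)
    (sum_normSq_col hM i) fun j _ => d.nonneg j

theorem conj_rpow_diag_concave {A₁ A₂ : Matrix n n ℂ} (hA₁ : A₁.PosSemidef)
    (hA₂ : A₂.PosSemidef) {a b : ℝ} (ha : 0 ≤ a) (hb : 0 ≤ b) (hab : a + b = 1)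
    (M : Matrix n n ℂ) {s : ℝ} (hs : s ∈ Set.Ioo 0 1) (i : n) :
    a * ((Mᴴ * A₁ ^ s * M) i i).re + b * ((Mᴴ * A₂ ^ s * M) i i).re
      ≤ ((Mᴴ * (a • A₁ + b • A₂) ^ s * M) i i).re := by
  have key (P : Matrix n n ℂ) :
      trace ((M * single i i 1)ᴴ * P * (M * single i i 1)) = (Mᴴ * P * M) i i := by
    rw [conjTranspose_mul, trace_mul_comm, trace_mul_comm,
      show (single i i (1 : ℂ))ᴴ * Mᴴ * P * (M * single i i 1)
        = (single i i 1)ᴴ * (Mᴴ * P * M) * single i i 1 by simp only [mul_assoc],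
      trace_mul_comm, conjTranspose_single, ← mul_assoc, star_one, single_mul_single_same, one_mul]
    simp [trace_single_mul]
  -- Taking both `W` equal to `1` removes that factor; the matrix unit selects one diagonal entry.
  have h := lieb_concavity hA₁ hA₂ PosSemidef.one PosSemidef.one ha hb (M * single i i 1) hs
  rw [← add_smul, hab, one_smul, CFC.one_rpow] at h
  simpa only [mul_one, key] using h

theorem trace_rpow_eq_sum_diag {X U : Matrix n n ℂ} (hU : U * Uᴴ = 1) (q : ℝ) :
    (trace (X ^ q)).re = ∑ i, ((Uᴴ * X ^ q * U) i i).re := by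
  rw [← Complex.re_sum]
  change _ = (trace (Uᴴ * X ^ q * U)).re
  rw [trace_mul_cycle, hU, one_mul]

theorem posSemidef_conj_rpow (A B : Matrix n n ℂ) (s : ℝ) : (Bᴴ * A ^ s * B).PosSemidef :=
  (posSemidef_rpow A s).conjTranspose_mul_mul_same B

theorem trace_conj_rpow_rpow_concave_of_le_one {A₁ A₂ : Matrix n n ℂ} (hA₁ : A₁.PosSemidef)
    (hA₂ : A₂.PosSemidef) {a b : ℝ} (ha : 0 ≤ a) (hb : 0 ≤ b) (hab : a + b = 1)
    (B : Matrix n n ℂ) {s q : ℝ} (hs : s ∈ Set.Ioo 0 1) (hq0 : 0 ≤ q) (hq1 : q ≤ 1) :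
    a * (trace ((Bᴴ * A₁ ^ s * B) ^ q)).re + b * (trace ((Bᴴ * A₂ ^ s * B) ^ q)).re
      ≤ (trace ((Bᴴ * (a • A₁ + b • A₂) ^ s * B) ^ q)).re := by
  have hX := posSemidef_conj_rpow (a • A₁ + b • A₂) B s
  -- In this basis the combination attains equality in Jensen, while the endpoints satisfy the
  -- inequality in the needed direction.
  obtain ⟨d⟩ := hX.exists_powDiag
  rw [d.trace_rpow, trace_rpow_eq_sum_diag (X := Bᴴ * A₁ ^ s * B) d.unitary_right,
    trace_rpow_eq_sum_diag (X := Bᴴ * A₂ ^ s * B) d.unitary_right,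
    Finset.mul_sum, Finset.mul_sum, ← Finset.sum_add_distrib]
  refine Finset.sum_le_sum fun i _ => ?_
  have e (A : Matrix n n ℂ) :
      d.Uᴴ * (Bᴴ * A ^ s * B) * d.U = (B * d.U)ᴴ * A ^ s * (B * d.U) := by
    rw [conjTranspose_mul]; simp only [mul_assoc]
  have hnn (A : Matrix n n ℂ) : 0 ≤ ((d.Uᴴ * (Bᴴ * A ^ s * B) * d.U) i i).re :=
    (Complex.le_def.1
      (((posSemidef_conj_rpow A B s).conjTranspose_mul_mul_same d.U).diag_nonneg (i := i))).1
  have hdiag : ((d.Uᴴ * (Bᴴ * (a • A₁ + b • A₂) ^ s * B) * d.U) i i).re = d.ev i := by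
    rw [d.conj_eq_diagonal hX, diagonal_apply_eq, Complex.ofReal_re]
  have h := conj_rpow_diag_concave hA₁ hA₂ ha hb hab (B * d.U) hs i
  rw [← e, ← e, ← e, hdiag] at h
  have h1 := (posSemidef_conj_rpow A₁ B s).conj_rpow_diag_re_le d.unitary_left hq0 hq1 i
  have h2 := (posSemidef_conj_rpow A₂ B s).conj_rpow_diag_re_le d.unitary_left hq0 hq1 i
  have h3 := (Real.concaveOn_rpow hq0 hq1).2 (hnn A₁) (hnn A₂) ha hb hab
  simp only [smul_eq_mul] at h3
  calc _ ≤ _ := add_le_add (mul_le_mul_of_nonneg_left h1 ha) (mul_le_mul_of_nonneg_left h2 hb)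
    _ ≤ _ := h3
    _ ≤ _ := Real.rpow_le_rpow (add_nonneg (mul_nonneg ha (hnn A₁)) (mul_nonneg hb (hnn A₂))) h hq0

theorem trace_conj_rpow_rpow_concave_of_one_lt {A₁ A₂ : Matrix n n ℂ} (hA₁ : A₁.PosSemidef)
    (hA₂ : A₂.PosSemidef) {a b : ℝ} (ha : 0 ≤ a) (hb : 0 ≤ b) (hab : a + b = 1)
    (B : Matrix n n ℂ) {s q : ℝ} (hs : s ∈ Set.Ioo 0 1) (hq : 1 < q) (hqs : q * s ≤ 1) :
    a * (trace ((Bᴴ * A₁ ^ s * B) ^ q)).re + b * (trace ((Bᴴ * A₂ ^ s * B) ^ q)).re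
      ≤ (trace ((Bᴴ * (a • A₁ + b • A₂) ^ s * B) ^ q)).re := by
  have hconj := Real.HolderConjugate.conjExponent hq
  set q' := q.conjExponent with hq'
  have hs1 : 0 < 1 - s := sub_pos.2 hs.2
  -- Equivalent to `q * s ≤ 1`; it makes the subtracted Young term convex in `W`.
  have hγ : 1 ≤ (1 - s) * q' := by
    rw [hq', Real.conjExponent, ← mul_div_assoc, one_le_div (by linarith)]
    linarith
  set X₁ := Bᴴ * A₁ ^ s * B with hX₁
  set X₂ := Bᴴ * A₂ ^ s * B with hX₂
  set X := Bᴴ * (a • A₁ + b • A₂) ^ s * B with hX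
  have pX₁ : X₁.PosSemidef := posSemidef_conj_rpow A₁ B s
  have pX₂ : X₂.PosSemidef := posSemidef_conj_rpow A₂ B s
  have pX : X.PosSemidef := posSemidef_conj_rpow _ B s
  have hδ : 0 ≤ (q - 1) / (1 - s) := div_nonneg (by linarith) hs1.le
  -- The exponent gives `W₁ ^ (1 - s) = X₁ ^ (q - 1)`, the equality case of Young; the combination
  -- of `W₁` and `W₂` is only a trial partner for `X`.
  set W₁ := X₁ ^ ((q - 1) / (1 - s)) with hW₁
  set W₂ := X₂ ^ ((q - 1) / (1 - s)) with hW₂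
  have pW₁ : W₁.PosSemidef := posSemidef_rpow _ _
  have pW₂ : W₂.PosSemidef := posSemidef_rpow _ _
  have pW : (a • W₁ + b • W₂).PosSemidef := (pW₁.smul ha).add (pW₂.smul hb)
  have young := trace_young pX (posSemidef_rpow (a • W₁ + b • W₂) (1 - s)) hconj
  rw [pW.rpow_rpow hs1.le hconj.symm.nonneg] at young
  have lieb := lieb_concavity hA₁ hA₂ pW₁ pW₂ ha hb B hs
  have conv := trace_rpow_convex pW₁ pW₂ hγ ha hb hab
  have e1 : (q - 1) / (1 - s) * (1 - s) = q - 1 := div_mul_cancel₀ _ hs1.ne'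
  have e2 : (q - 1) / (1 - s) * ((1 - s) * q') = q := by
    rw [← mul_assoc, e1, hconj.sub_one_mul_conj]
  rw [← hX₁, ← hX₂, ← hX, pX₁.rpow_rpow hδ hs1.le, pX₂.rpow_rpow hδ hs1.le, e1,
    pX₁.trace_mul_rpow (by linarith), pX₂.trace_mul_rpow (by linarith), add_sub_cancel] at lieb
  rw [pX₁.rpow_rpow hδ (by linarith), pX₂.rpow_rpow hδ (by linarith), e2] at conv
  have hinv : q'⁻¹ = 1 - q⁻¹ := by linarith [hconj.inv_add_inv_eq_one]
  have h1 := mul_le_mul_of_nonneg_right conv hconj.symm.inv_nonneg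
  simp only [div_eq_mul_inv] at young
  rw [hinv] at h1 young
  have hqi : 0 < q⁻¹ := by positivity
  refine le_of_mul_le_mul_right ?_ hqi
  linarith

end Matrix

theorem corollary3p4 (m : ℕ) (B : Matrix (Fin m) (Fin m) ℂ) (s r : ℝ)
    (hs0 : 0 < s) (hs1 : s < 1) (hr0 : 0 < r) (hr1 : r ≤ 1) :
    ConcaveOn ℝ {A : Matrix (Fin m) (Fin m) ℂ | A.PosSemidef}
      (fun A : Matrix (Fin m) (Fin m) ℂ =>
        (Matrix.trace ((Bᴴ * A ^ s * B) ^ (r / s))).re) := by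
  refine ⟨fun X hX Y hY a b ha hb _ => (Matrix.PosSemidef.smul hX ha).add
    (Matrix.PosSemidef.smul hY hb), fun X hX Y hY a b ha hb hab => ?_⟩
  rcases le_or_gt (r / s) 1 with h | h
  · exact Matrix.trace_conj_rpow_rpow_concave_of_le_one hX hY ha hb hab B ⟨hs0, hs1⟩
      (by positivity) h
  · exact Matrix.trace_conj_rpow_rpow_concave_of_one_lt hX hY ha hb hab B ⟨hs0, hs1⟩ h
      (by rwa [div_mul_cancel₀ _ hs0.ne'])
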